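/- Let $\mathbb A=\mathbb R\times\prod'_p(\mathbb Q_p,\mathbb Z_p)$ be the adele ring of $\mathbb Q$ and $\mathbb A^\times$ the idele group. For $x=(x_\infty,(x_p)_p)\in\mathbb A^\times$ put $$f(x)=e^{-\pi x_\infty^2}\prod_p \mathbf 1_{\mathbb Z_p}(x_p),\qquad |x|=|x_\infty|_\infty\prod_p|x_p|_p ,$$ and let $d^\times x$ be the product of the local multiplicative Haar measures: $dx_\infty/|x_\infty|_\infty$ on $\mathbb R^\times$ (positive and negative reals), and, on the finite ideles, the product of the Haar measures on $\mathbb Q_p^\times$ giving $\mathbb Z_p^\times$ mass $1$, i.e. the Haar measure giving $\prod_p\mathbb Z_p^\times$ mass $1$. Let $\theta(\tau)=\sum_{n\in\mathbb Z}e^{\pi i n^2\tau}$ for $\operatorname{Im}\tau>0$. Then for all $s_1,s_2\in\mathbb C$ with $\operatorname{Re}(s_2)>1$ and $\operatorname{Re}(s_1+s_2)>2$, both integrals below converge absolutely and $$\int_{|x_1|>|x_2|}f(x_1)|x_1|^{s_1}\,d^\times x_1\; f(x_2)|x_2|^{s_2}\,d^\times x_2 =\frac14\int_{r_1>r_2>0}(\theta(ir_1)-1)\,r_1^{s_1/2}\,\frac{dr_1}{r_1}\;(\theta(ir_2)-1)\,r_2^{s_2/2}\,\frac{dr_2}{r_2},$$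 where the left side is an integral over pairs $(x_1,x_2)\in\mathbb A^\times\times\mathbb A^\times$ and the right side is an iterated integral along the imaginary axis (the geodesic from $0$ to $i\infty$). -/

import Mathlib

open scoped RestrictedProduct

noncomputable section

namespace Adelic

instance factPrime (p : Nat.Primes) : Fact (p : ℕ).Prime := ⟨p.2⟩

/-- The ring of finite adeles of `ℚ`: the restricted product of the fields `ℚ_p` with respect to
the subrings `ℤ_p`, with its restricted product topology. -/
abbrev FiniteAdele : Type :=
  Πʳ p : Nat.Primes, [ℚ_[(p : ℕ)], PadicInt.subring (p : ℕ)]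

/-- The adele ring of `ℚ`. -/
abbrev Adele : Type := ℝ × FiniteAdele

/-- The finite ideles of `ℚ`, with the topology of a unit group. -/
abbrev FiniteIdele : Type := FiniteAdeleˣ

/-- The ideles of `ℚ`, with the topology of a unit group. -/
abbrev Idele : Type := Adeleˣ

instance : MeasurableSpace FiniteIdele := borel _

instance : BorelSpace FiniteIdele := ⟨rfl⟩

instance : MeasurableSpace Idele := borel _

instance : BorelSpace Idele := ⟨rfl⟩

/-- The profinite completion of `ℤ`, inside the finite adeles. -/
def integralAdeles : Set FiniteAdele := {a | ∀ p : Nat.Primes, a p ∈ PadicInt.subring (p : ℕ)}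

theorem isOpen_padicInt (p : Nat.Primes) :
    IsOpen ((PadicInt.subring (p : ℕ) : Subring ℚ_[(p : ℕ)]) : Set ℚ_[(p : ℕ)]) := by
  have h : ((PadicInt.subring (p : ℕ) : Subring ℚ_[(p : ℕ)]) : Set ℚ_[(p : ℕ)]) =
      Metric.closedBall 0 1 := by
    ext y
    simp [PadicInt.subring]
  rw [h]
  exact IsUltrametricDist.isOpen_closedBall (0 : ℚ_[(p : ℕ)]) one_ne_zero

instance factOpen : Fact (∀ p : Nat.Primes,
    IsOpen ((PadicInt.subring (p : ℕ) : Subring ℚ_[(p : ℕ)]) : Set ℚ_[(p : ℕ)])) :=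
  ⟨isOpen_padicInt⟩

theorem isOpen_integralAdeles : IsOpen integralAdeles :=
  RestrictedProduct.isOpen_forall_mem isOpen_padicInt

theorem isCompact_integralAdeles : IsCompact integralAdeles := by
  have : ∀ p : Nat.Primes,
      CompactSpace ((PadicInt.subring (p : ℕ) : Subring ℚ_[(p : ℕ)]) : Set ℚ_[(p : ℕ)]) :=
    fun p => PadicInt.compactSpace (p : ℕ)
  have h : integralAdeles = Set.range (RestrictedProduct.structureMap
      (fun p : Nat.Primes => ℚ_[(p : ℕ)])
      (fun p : Nat.Primes => ((PadicInt.subring (p : ℕ) : Subring ℚ_[(p : ℕ)]) : Set ℚ_[(p : ℕ)]))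
      Filter.cofinite) := by
    ext a
    constructor
    · intro ha
      exact ⟨fun p => ⟨a p, ha p⟩, by ext p; rfl⟩
    · rintro ⟨b, rfl⟩ p
      exact (b p).2
  rw [h]
  exact isCompact_range RestrictedProduct.isEmbedding_structureMap.continuous

/-- The group of finite ideles all of whose coordinates are `p`-adic units, that is, the
unit group of the profinite completion of `ℤ`. -/
def unitIdeles : Set FiniteIdele := {x | ∀ p : Nat.Primes, ‖(x : FiniteAdele) p‖ = 1}

theorem unitIdeles_eq : unitIdeles =
    {x : FiniteIdele | (x : FiniteAdele) ∈ integralAdeles ∧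
      ((x⁻¹ : FiniteIdele) : FiniteAdele) ∈ integralAdeles} := by
  ext x
  have key : ∀ p : Nat.Primes,
      ‖(x : FiniteAdele) p‖ * ‖((x⁻¹ : FiniteIdele) : FiniteAdele) p‖ = 1 := by
    intro p
    have h : (x : FiniteAdele) p * ((x⁻¹ : FiniteIdele) : FiniteAdele) p = 1 := by
      exact congrArg (fun a : FiniteAdele => a p) x.mul_inv
    rw [← norm_mul, h, norm_one]
  have e : ∀ (p : Nat.Primes) (y : ℚ_[(p : ℕ)]), y ∈ PadicInt.subring (p : ℕ) ↔ ‖y‖ ≤ 1 :=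
    fun p y => Iff.rfl
  simp only [unitIdeles, integralAdeles, Set.mem_ofPred_eq, e]
  constructor
  · intro h
    refine ⟨fun p => (h p).le, fun p => ?_⟩
    have := key p
    rw [h p, one_mul] at this
    exact this.le
  · rintro ⟨h1, h2⟩ p
    refine le_antisymm (h1 p) ?_
    calc (1 : ℝ) = ‖(x : FiniteAdele) p‖ * ‖((x⁻¹ : FiniteIdele) : FiniteAdele) p‖ := (key p).symm
      _ ≤ ‖(x : FiniteAdele) p‖ * 1 := mul_le_mul_of_nonneg_left (h2 p) (norm_nonneg _)
      _ = _ := mul_one _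

theorem isOpen_unitIdeles : IsOpen unitIdeles := by
  rw [unitIdeles_eq]
  exact (isOpen_integralAdeles.preimage Units.continuous_val).inter
    (isOpen_integralAdeles.preimage (Units.continuous_val.comp continuous_inv))

theorem isCompact_unitIdeles : IsCompact unitIdeles := by
  rw [Units.isEmbedding_embedProduct.isCompact_iff]
  have h : Units.embedProduct FiniteAdele '' unitIdeles =
      (integralAdeles ×ˢ (MulOpposite.unop ⁻¹' integralAdeles)) ∩
        {q : FiniteAdele × FiniteAdeleᵐᵒᵖ | q.1 * q.2.unop = 1} := by
    rw [unitIdeles_eq]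
    ext ⟨a, b⟩
    constructor
    · rintro ⟨x, ⟨h1, h2⟩, h3⟩
      simp only [Units.embedProduct_apply, Prod.mk.injEq] at h3
      obtain ⟨rfl, rfl⟩ := h3
      exact ⟨⟨h1, h2⟩, x.mul_inv⟩
    · rintro ⟨⟨h1, h2⟩, h3⟩
      exact ⟨⟨a, b.unop, h3, by rw [mul_comm]; exact h3⟩, ⟨h1, h2⟩, rfl⟩
  rw [h]
  refine IsCompact.inter_right (isCompact_integralAdeles.prod ?_) ?_
  · have : (MulOpposite.unop ⁻¹' integralAdeles : Set FiniteAdeleᵐᵒᵖ) =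
        MulOpposite.op '' integralAdeles := by
      ext b
      exact ⟨fun hb => ⟨b.unop, hb, rfl⟩, by rintro ⟨a, ha, rfl⟩; exact ha⟩
    rw [this]
    exact isCompact_integralAdeles.image MulOpposite.continuous_op
  · exact isClosed_eq (continuous_fst.mul (MulOpposite.continuous_unop.comp continuous_snd))
      continuous_const

/-- The unit finite ideles as a compact set with non-empty interior. -/
def unitIdelesCompact : TopologicalSpace.PositiveCompacts FiniteIdele where
  carrier := unitIdeles
  isCompact' := isCompact_unitIdeles
  interior_nonempty' := by
    rw [isOpen_unitIdeles.interior_eq]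
    exact ⟨1, fun p => by simp⟩

/-- The product over the primes `p` of the Haar measures on `ℚ_pˣ` that give `ℤ_pˣ` mass one:
the Haar measure on the finite ideles that gives the product of the `ℤ_pˣ` mass one. -/
def finiteMeasure : MeasureTheory.Measure FiniteIdele :=
  MeasureTheory.Measure.haarMeasure unitIdelesCompact

/-- The multiplicative Haar measure `dx / |x|` on `ℝˣ` (positive and negative reals). -/
def realMeasure : MeasureTheory.Measure ℝˣ :=
  (MeasureTheory.volume.withDensity (fun x : ℝ => ENNReal.ofReal |x|⁻¹)).comap Units.val

instance : BorelSpace ℝˣ := by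
  constructor
  change MeasurableSpace.comap Units.val _ = _
  rw [BorelSpace.measurable_eq (α := ℝ), (Units.isEmbedding_val₀ (G₀ := ℝ)).eq_induced,
    borel_comap]

instance : SecondCountableTopology ℝˣ :=
  (Units.isEmbedding_val₀ (G₀ := ℝ)).secondCountableTopology

theorem measurable_prodUnits_symm :
    Measurable (MulEquiv.prodUnits (M := ℝ) (N := FiniteAdele)).symm :=
  (Homeomorph.prodUnits (α := ℝ) (β := FiniteAdele)).symm.continuous.measurable

/-- The product measure on the ideles, transported along `ℝˣ × 𝔸_fˣ ≃ (ℝ × 𝔸_f)ˣ`. -/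
def ideleMeasure : MeasureTheory.Measure Idele :=
  (realMeasure.prod finiteMeasure).map (MulEquiv.prodUnits (M := ℝ) (N := FiniteAdele)).symm

/-- The characteristic function of `ℤ_p`. -/
def localFun (p : Nat.Primes) (y : ℚ_[(p : ℕ)]) : ℝ :=
  (Set.indicator (PadicInt.subring (p : ℕ) : Set ℚ_[(p : ℕ)]) 1 : ℚ_[(p : ℕ)] → ℝ) y

/-- The function `exp (-π x_∞ ^ 2) * ∏ p, 1_{ℤ_p} (x_p)`. For an idele almost all factors are
equal to one. -/
def ideleFun (x : Idele) : ℝ :=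
  Real.exp (-Real.pi * (x : Adele).1 ^ 2) * ∏ᶠ p : Nat.Primes, localFun p ((x : Adele).2 p)

/-- The idele norm `|x_∞| * ∏ p, |x_p|_p`. For an idele almost all factors are equal to one. -/
def ideleNorm (x : Idele) : ℝ :=
  |(x : Adele).1| * ∏ᶠ p : Nat.Primes, ‖(x : Adele).2 p‖

/-- The density `f(x₁) |x₁|^{s₁} f(x₂) |x₂|^{s₂}` with respect to `d^×x₁ d^×x₂`. -/
def adelicIntegrand (s₁ s₂ : ℂ) (x : Idele × Idele) : ℂ :=
  (ideleFun x.1 * (ideleNorm x.1 : ℂ) ^ s₁) * (ideleFun x.2 * (ideleNorm x.2 : ℂ) ^ s₂)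

/-- The domain `|x₁| > |x₂|`. -/
def adelicDomain : Set (Idele × Idele) := {x | ideleNorm x.1 > ideleNorm x.2}

/-- The density, with respect to `dr₁ dr₂`, of
`(θ(ir₁) - 1) r₁^{s₁/2} dr₁/r₁ (θ(ir₂) - 1) r₂^{s₂/2} dr₂/r₂`, where
`θ(τ) = ∑ n : ℤ, exp (π i n² τ)`. -/
def thetaIntegrand (s₁ s₂ : ℂ) (r : ℝ × ℝ) : ℂ :=
  ((jacobiTheta (Complex.I * r.1) - 1) * (r.1 : ℂ) ^ (s₁ / 2) / r.1) *
    ((jacobiTheta (Complex.I * r.2) - 1) * (r.2 : ℂ) ^ (s₂ / 2) / r.2)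

/-- The domain `r₁ > r₂ > 0`. -/
def thetaDomain : Set (ℝ × ℝ) := {r | r.1 > r.2 ∧ r.2 > 0}

end Adelic

end

namespace Adelic

open MeasureTheory Set

/-! Apart from the weight `f`, both sides depend on an idele only through its norm, so everything
reduces to one push-forward: under `x ↦ |x|²` the measure `f(x) d^×x` becomes `(θ(ir) - 1) dr /
(2r)` on `r > 0` (`map_weightedMeasure`). Squaring preserves the order of the norms and turns
`|x|^s` into `r^(s/2)`. The double integral is then an integral against a product of two such
measures, and the two factors `1/2` give the `1/4`.

The push-forward rests on the fact that every finite idele is a positive rational times a unit. The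
integral finite ideles are therefore the disjoint union over `n ≥ 1` of the cosets `n·∏ ℤ_pˣ`, each
of mass one and norm `1/n` (`setLIntegral_integralIdeles`). On the `n`-th coset the substitution `t
= n√r` at the real place produces `exp(-πn²r) dr/r` (`lintegral_Ioi_gaussian`), and these sum to
`(θ(ir) - 1) dr / (2r)`.

For convergence, the `a`-th moment of this measure is `π^(-a) Γ(a) ζ(2a)`, finite for `a > 1/2`. On
`r₁ > r₂` one may insert a factor `(r₁/r₂)^t ≥ 1` to bring both exponents above `1/2`. -/

/-! ### Coordinates and norm of finite ideles -/

theorem FiniteIdele.mul_apply (x y : FiniteIdele) (p : Nat.Primes) :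
    ((x * y : FiniteIdele) : FiniteAdele) p = (x : FiniteAdele) p * (y : FiniteAdele) p := rfl

theorem FiniteIdele.apply_mul_inv (x : FiniteIdele) (p : Nat.Primes) :
    (x : FiniteAdele) p * ((x⁻¹ : FiniteIdele) : FiniteAdele) p = 1 :=
  congrArg (fun a : FiniteAdele => a p) x.mul_inv

theorem FiniteIdele.apply_ne_zero (x : FiniteIdele) (p : Nat.Primes) :
    (x : FiniteAdele) p ≠ 0 :=
  left_ne_zero_of_mul_eq_one (x.apply_mul_inv p)

theorem FiniteIdele.inv_apply (x : FiniteIdele) (p : Nat.Primes) :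
    ((x⁻¹ : FiniteIdele) : FiniteAdele) p = ((x : FiniteAdele) p)⁻¹ :=
  eq_inv_of_mul_eq_one_right (x.apply_mul_inv p)

theorem FiniteAdele.finite_not_mem (a : FiniteAdele) :
    {p : Nat.Primes | ¬ ‖a p‖ ≤ 1}.Finite :=
  Filter.eventually_cofinite.1 a.2

theorem FiniteIdele.finite_norm_ne_one (x : FiniteIdele) :
    {p : Nat.Primes | ‖(x : FiniteAdele) p‖ ≠ 1}.Finite := by
  refine ((FiniteAdele.finite_not_mem (x : FiniteAdele)).union
    (FiniteAdele.finite_not_mem ((x⁻¹ : FiniteIdele) : FiniteAdele))).subset fun p hp => ?_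
  by_contra h
  simp only [mem_union, mem_ofPred_eq, not_or, not_not] at h
  obtain ⟨h1, h2⟩ := h
  rw [FiniteIdele.inv_apply, norm_inv] at h2
  exact hp (le_antisymm h1 ((inv_le_one₀ (norm_pos_iff.2 (x.apply_ne_zero p))).1 h2))

/-- The norm of a finite idele. -/
noncomputable def finiteNorm (x : FiniteIdele) : ℝ := ∏ᶠ p : Nat.Primes, ‖(x : FiniteAdele) p‖

theorem finiteNorm_mul (x y : FiniteIdele) :
    finiteNorm (x * y) = finiteNorm x * finiteNorm y := by
  unfold finiteNorm
  rw [← finprod_mul_distrib x.finite_norm_ne_one y.finite_norm_ne_one]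
  exact finprod_congr fun p => by rw [FiniteIdele.mul_apply, norm_mul]

theorem finiteNorm_of_mem_unitIdeles {x : FiniteIdele} (hx : x ∈ unitIdeles) :
    finiteNorm x = 1 := by
  unfold finiteNorm
  rw [finprod_congr hx, finprod_one]

theorem finiteNorm_pos (x : FiniteIdele) : 0 < finiteNorm x :=
  finprod_induction (fun r : ℝ => 0 < r) one_pos (fun _ _ => mul_pos)
    fun p => norm_pos_iff.2 (x.apply_ne_zero p)

theorem one_mem_unitIdeles : (1 : FiniteIdele) ∈ unitIdeles := fun p => by simp

/-- The norm is multiplicative and trivial on the open subgroup of units, hence constant on its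
cosets. -/
theorem isLocallyConstant_finiteNorm : IsLocallyConstant finiteNorm := by
  rw [IsLocallyConstant.iff_exists_open]
  intro x
  refine ⟨(fun y => x⁻¹ * y) ⁻¹' unitIdeles,
    isOpen_unitIdeles.preimage (continuous_const_mul x⁻¹), ?_, fun y hy => ?_⟩
  · simpa using one_mem_unitIdeles
  · have h := finiteNorm_of_mem_unitIdeles hy
    calc finiteNorm y = finiteNorm (x * (x⁻¹ * y)) := by rw [mul_inv_cancel_left]
      _ = finiteNorm x := by rw [finiteNorm_mul, h, mul_one]

theorem measurable_finiteNorm : Measurable finiteNorm :=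
  isLocallyConstant_finiteNorm.continuous.measurable

/-! ### Decomposition of finite ideles into positive rationals and units -/

theorem finite_primes_dvd {n : ℕ} (hn : n ≠ 0) : {p : Nat.Primes | (p : ℕ) ∣ n}.Finite := by
  refine Finite.of_finite_image (f := fun p : Nat.Primes => (p : ℕ))
    (n.primeFactors.finite_toSet.subset ?_) Subtype.val_injective.injOn
  rintro _ ⟨p, hp, rfl⟩
  exact Nat.mem_primeFactors.2 ⟨p.2, hp, hn⟩

/-- The diagonal image of a positive integer in the finite ideles. -/
noncomputable def natIdele (n : ℕ) (hn : n ≠ 0) : FiniteIdele where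
  val := ⟨fun p => (n : ℚ_[(p : ℕ)]), Filter.Eventually.of_forall fun p =>
    (Padic.norm_int_le_one (p := (p : ℕ)) n : ‖((n : ℤ) : ℚ_[(p : ℕ)])‖ ≤ 1)⟩
  inv := ⟨fun p => (n : ℚ_[(p : ℕ)])⁻¹, by
    refine Filter.eventually_cofinite.2 ((finite_primes_dvd hn).subset fun p hp => ?_)
    by_contra h
    refine hp ?_
    change ‖(n : ℚ_[(p : ℕ)])⁻¹‖ ≤ 1
    rw [norm_inv, Padic.norm_natCast_eq_one_iff.2 ((Nat.Prime.coprime_iff_not_dvd p.2).2 h), inv_one]⟩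
  val_inv := by
    ext p
    exact mul_inv_cancel₀ (Nat.cast_ne_zero.2 hn : (n : ℚ_[(p : ℕ)]) ≠ 0)
  inv_val := by
    ext p
    exact inv_mul_cancel₀ (Nat.cast_ne_zero.2 hn : (n : ℚ_[(p : ℕ)]) ≠ 0)

theorem natIdele_apply (n : ℕ) (hn : n ≠ 0) (p : Nat.Primes) :
    (natIdele n hn : FiniteAdele) p = (n : ℚ_[(p : ℕ)]) := rfl

theorem natIdele_one (h : 1 ≠ 0) : natIdele 1 h = 1 := by
  ext p
  simp [natIdele_apply]

theorem natIdele_mul (m n : ℕ) (hm : m ≠ 0) (hn : n ≠ 0) :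
    natIdele (m * n) (mul_ne_zero hm hn) = natIdele m hm * natIdele n hn := by
  ext p
  rw [FiniteIdele.mul_apply, natIdele_apply, natIdele_apply, natIdele_apply, Nat.cast_mul]

theorem finiteNorm_natIdele (n : ℕ) (hn : n ≠ 0) : finiteNorm (natIdele n hn) = (n : ℝ)⁻¹ := by
  induction n using induction_on_primes with
  | zero => exact absurd rfl hn
  | one =>
    rw [natIdele_one, finiteNorm_of_mem_unitIdeles one_mem_unitIdeles, Nat.cast_one, inv_one]
  | prime_mul q a hq ih =>
    have ha : a ≠ 0 := right_ne_zero_of_mul hn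
    rw [natIdele_mul q a hq.ne_zero ha, finiteNorm_mul, ih ha, Nat.cast_mul, mul_inv]
    congr 1
    unfold finiteNorm
    refine (finprod_eq_single (fun p : Nat.Primes => ‖(natIdele q hq.ne_zero : FiniteAdele) p‖)
      (⟨q, hq⟩ : Nat.Primes) fun p hp => ?_).trans ?_
    · change ‖(natIdele q hq.ne_zero : FiniteAdele) p‖ = 1
      rw [natIdele_apply]
      refine Padic.norm_natCast_eq_one_iff.2 ((Nat.coprime_primes p.2 hq).2 fun h => hp ?_)
      exact Subtype.ext h
    · exact Padic.norm_p (hp := ⟨hq⟩)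

/-- There is a positive integer with any prescribed valuations. -/
theorem exists_nat_norm_eq (f : Nat.Primes → ℕ) (hf : {p | f p ≠ 0}.Finite) :
    ∃ n : ℕ, n ≠ 0 ∧ ∀ p : Nat.Primes, ‖(n : ℚ_[(p : ℕ)])‖ = ((p : ℕ) : ℝ) ^ (-(f p : ℤ)) := by
  classical
  -- The exponents are extended by zero from primes to all of `ℕ`, so that `∏ p ^ g p` has
  -- factorization `g`.
  let g : ℕ →₀ ℕ := (Finsupp.ofSupportFinite f hf).embDomain ⟨Subtype.val, Subtype.val_injective⟩
  have hg : ∀ p ∈ g.support, p.Prime := by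
    intro p hp
    obtain ⟨q, -, rfl⟩ := Finset.mem_map.1 hp
    exact q.2
  have hfac := Nat.prod_pow_factorization_eq_self hg
  set n := g.prod fun x1 x2 => x1 ^ x2
  have hn : n ≠ 0 := by
    refine Finset.prod_ne_zero_iff.2 fun p hp => pow_ne_zero _ (hg p hp).ne_zero
  refine ⟨n, hn, fun p => ?_⟩
  have hp : g p = f p := Finsupp.embDomain_apply_self
    ⟨Subtype.val, Subtype.val_injective⟩ (Finsupp.ofSupportFinite f hf) p
  rw [Padic.norm_eq_zpow_neg_valuation (Nat.cast_ne_zero.2 hn), Padic.valuation_natCast,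
    ← Nat.factorization_def n p.2, hfac, hp]

/-- Every finite idele is a positive rational number times a unit. -/
theorem exists_eq_natIdele_mul (x : FiniteIdele) : ∃ (m n : ℕ) (hm : m ≠ 0) (hn : n ≠ 0),
    (natIdele m hm)⁻¹ * natIdele n hn * x⁻¹ ∈ unitIdeles ∧
      ((x : FiniteAdele) ∈ integralAdeles → m = 1) := by
  have hv : ∀ p : Nat.Primes, ‖(x : FiniteAdele) p‖ = 1 → ((x : FiniteAdele) p).valuation = 0 := by
    intro p hp
    rw [Padic.norm_eq_zpow_neg_valuation (x.apply_ne_zero p)] at hp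
    have h1 : (1 : ℝ) < (p : ℕ) := Nat.one_lt_cast.2 p.2.one_lt
    have := (zpow_eq_one_iff_right₀ (zero_le_one.trans h1.le) h1.ne').1 hp
    omega
  obtain ⟨n, hn, hnp⟩ := exists_nat_norm_eq (fun p => ((x : FiniteAdele) p).valuation.toNat)
    (x.finite_norm_ne_one.subset fun p hp h => hp (by simp [hv p h]))
  -- The numerator `n` carries the positive parts of the valuations of `x` and the denominator `m`
  -- the negative parts; `toNat` truncates at zero.
  have hunit (m : ℕ) (hm : m ≠ 0) (hmp : ∀ p : Nat.Primes, ‖(m : ℚ_[(p : ℕ)])‖ =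
      ((p : ℕ) : ℝ) ^ (-((-((x : FiniteAdele) p).valuation).toNat : ℤ))) :
      (natIdele m hm)⁻¹ * natIdele n hn * x⁻¹ ∈ unitIdeles := by
    intro p
    have h0 : ((p : ℕ) : ℝ) ≠ 0 := Nat.cast_ne_zero.2 p.2.ne_zero
    rw [FiniteIdele.mul_apply, FiniteIdele.mul_apply, FiniteIdele.inv_apply,
      FiniteIdele.inv_apply, natIdele_apply, natIdele_apply, norm_mul, norm_mul, norm_inv, norm_inv,
      hmp, hnp, Padic.norm_eq_zpow_neg_valuation (x.apply_ne_zero p), ← zpow_neg, ← zpow_neg,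
      ← zpow_add₀ h0, ← zpow_add₀ h0]
    convert zpow_zero _
    omega
  by_cases hx : (x : FiniteAdele) ∈ integralAdeles
  · refine ⟨1, n, one_ne_zero, hn, hunit 1 _ fun p => ?_, fun _ => rfl⟩
    have : 0 ≤ ((x : FiniteAdele) p).valuation := (Padic.norm_le_one_iff_val_nonneg _).1 (hx p)
    rw [Int.toNat_of_nonpos (by omega)]
    simp
  · obtain ⟨m, hm, hmp⟩ := exists_nat_norm_eq
      (fun p => (-((x : FiniteAdele) p).valuation).toNat)
      (x.finite_norm_ne_one.subset fun p hp h => hp (by simp [hv p h]))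
    exact ⟨m, n, hm, hn, hunit m hm hmp, fun h => absurd h hx⟩

theorem inv_mem_unitIdeles {x : FiniteIdele} (hx : x ∈ unitIdeles) : x⁻¹ ∈ unitIdeles := by
  intro p
  rw [FiniteIdele.inv_apply, norm_inv, hx p, inv_one]

/-- Countably many translates of the compact unit group, by positive rationals, cover the group.
This makes the Haar measure σ-finite, as Tonelli's theorem requires. -/
instance : SigmaCompactSpace FiniteIdele := by
  have h := isSigmaCompact_iUnion_of_isCompact
    (fun q : {n : ℕ // n ≠ 0} × {n : ℕ // n ≠ 0} =>
      (fun y => (natIdele q.1 q.1.2)⁻¹ * natIdele q.2 q.2.2 * y) '' unitIdeles)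
    fun q => isCompact_unitIdeles.image (continuous_const_mul _)
  refine ⟨?_⟩
  convert h
  refine (eq_univ_of_forall fun x => ?_).symm
  obtain ⟨m, n, hm, hn, hx, -⟩ := exists_eq_natIdele_mul x
  refine mem_iUnion.2 ⟨(⟨m, hm⟩, ⟨n, hn⟩), _, inv_mem_unitIdeles hx, ?_⟩
  change (natIdele m hm)⁻¹ * natIdele n hn * _ = x
  rw [mul_inv_rev, inv_inv, mul_comm x, mul_inv_cancel_left]

instance : SigmaFinite finiteMeasure := by
  unfold finiteMeasure
  infer_instance

/-! ### Integral finite ideles sliced by norm -/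

/-- The integral finite ideles. -/
def integralIdeles : Set FiniteIdele := {x | (x : FiniteAdele) ∈ integralAdeles}

theorem measurableSet_integralIdeles : MeasurableSet integralIdeles :=
  (isOpen_integralAdeles.preimage Units.continuous_val).measurableSet

/-- The integral finite ideles of norm `1 / (n + 1)`. -/
def integralIdelesOfNorm (n : ℕ) : Set FiniteIdele :=
  integralIdeles ∩ finiteNorm ⁻¹' {((n + 1 : ℕ) : ℝ)⁻¹}

theorem iUnion_integralIdelesOfNorm : ⋃ n, integralIdelesOfNorm n = integralIdeles := by
  refine Subset.antisymm (iUnion_subset fun n => inter_subset_left) fun x hx => ?_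
  obtain ⟨m, n, hm, hn, hu, h1⟩ := exists_eq_natIdele_mul x
  obtain rfl := h1 hx
  -- Slice `n - 1` has norm `1/n`, because of the shift in the indexing.
  refine mem_iUnion.2 ⟨n - 1, hx, ?_⟩
  have h := finiteNorm_of_mem_unitIdeles (inv_mem_unitIdeles hu)
  have h' : x = natIdele n hn * (natIdele 1 hm)⁻¹ *
      ((natIdele 1 hm)⁻¹ * natIdele n hn * x⁻¹)⁻¹ := by
    rw [mul_inv_rev, inv_inv, mul_comm x, mul_comm (natIdele n hn), mul_inv_cancel_left]
  rw [mem_preimage, mem_singleton_iff, Nat.sub_add_cancel (Nat.one_le_iff_ne_zero.2 hn), h',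
    finiteNorm_mul, h, natIdele_one, inv_one, mul_one, mul_one, finiteNorm_natIdele]

/-- An integral idele is a positive integer times a unit, and the norm recovers that integer. Each
slice is thus a single coset of the units, of mass one by invariance. -/
theorem integralIdelesOfNorm_eq (n : ℕ) : integralIdelesOfNorm n =
    (fun y => (natIdele (n + 1) n.succ_ne_zero)⁻¹ * y) ⁻¹' unitIdeles := by
  ext x
  constructor
  · rintro ⟨hx, hxn⟩
    obtain ⟨m, k, hm, hk, hu, h1⟩ := exists_eq_natIdele_mul x
    obtain rfl := h1 hx
    rw [natIdele_one, inv_one, one_mul] at hu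
    have h := finiteNorm_of_mem_unitIdeles (inv_mem_unitIdeles hu)
    have h2 : x = natIdele k hk * (natIdele k hk * x⁻¹)⁻¹ := by
      rw [mul_inv_rev, inv_inv, mul_comm x, mul_inv_cancel_left]
    rw [mem_preimage, mem_singleton_iff, h2, finiteNorm_mul, h, mul_one, finiteNorm_natIdele,
      inv_inj, Nat.cast_inj] at hxn
    subst hxn
    have := inv_mem_unitIdeles hu
    rwa [mul_inv_rev, inv_inv, mul_comm x] at this
  · intro hx
    have h2 : x = natIdele (n + 1) n.succ_ne_zero * ((natIdele (n + 1) n.succ_ne_zero)⁻¹ * x) := by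
      rw [mul_inv_cancel_left]
    constructor
    · intro p
      change ‖(x : FiniteAdele) p‖ ≤ 1
      rw [h2, FiniteIdele.mul_apply, norm_mul, hx p, mul_one, natIdele_apply]
      exact Padic.norm_int_le_one (p := (p : ℕ)) (n + 1 : ℕ)
    · rw [mem_preimage, mem_singleton_iff, h2, finiteNorm_mul, finiteNorm_of_mem_unitIdeles hx,
        mul_one, finiteNorm_natIdele]

theorem finiteMeasure_integralIdelesOfNorm (n : ℕ) :
    finiteMeasure (integralIdelesOfNorm n) = 1 := by
  rw [integralIdelesOfNorm_eq, finiteMeasure, measure_preimage_mul]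
  exact Measure.haarMeasure_self

/-- The integrand is constant on each slice, so `G` need not be measurable. -/
theorem setLIntegral_integralIdeles (G : ℝ → ENNReal) :
    ∫⁻ y in integralIdeles, G (finiteNorm y) ∂finiteMeasure =
      ∑' n : ℕ, G ((n + 1 : ℕ) : ℝ)⁻¹ := by
  have hm (n : ℕ) : MeasurableSet (integralIdelesOfNorm n) :=
    measurableSet_integralIdeles.inter (measurable_finiteNorm (measurableSet_singleton _))
  rw [← iUnion_integralIdelesOfNorm, lintegral_iUnion hm]
  · refine tsum_congr fun n => ?_
    rw [setLIntegral_congr_fun (hm n) (g := fun _ => G ((n + 1 : ℕ) : ℝ)⁻¹)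
      fun y hy => congrArg G hy.2, setLIntegral_const, finiteMeasure_integralIdelesOfNorm, mul_one]
  · intro i j hij
    refine disjoint_left.2 fun x hi hj => hij ?_
    have h := hi.2.symm.trans hj.2
    rw [inv_inj, Nat.cast_inj] at h
    omega

/-! ### Integration at the real place -/

theorem measurableEmbedding_units_val : MeasurableEmbedding (Units.val : ℝˣ → ℝ) :=
  Units.isOpenEmbedding_val.measurableEmbedding

theorem map_val_realMeasure : realMeasure.map Units.val =
    (volume.withDensity fun x : ℝ => ENNReal.ofReal |x|⁻¹).restrict (range Units.val) :=
  measurableEmbedding_units_val.map_comap _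

instance : SigmaFinite realMeasure := by
  refine SigmaFinite.of_map _ measurableEmbedding_units_val.measurable.aemeasurable ?_
  rw [map_val_realMeasure]
  infer_instance

theorem lintegral_Iio_abs (f : ℝ → ENNReal) :
    ∫⁻ x in Iio 0, f |x| = ∫⁻ x in Ioi 0, f x := by
  have h : MeasurePreserving (Neg.neg : ℝ → ℝ) volume volume := Measure.measurePreserving_neg volume
  have h2 := h.setLIntegral_comp_emb (MeasurableEquiv.neg ℝ).measurableEmbedding
    (fun x => f |x|) (Ioi 0)
  simp only [abs_neg, image_neg_eq_neg, neg_Ioi, neg_zero] at h2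
  rw [← h2]
  exact setLIntegral_congr_fun measurableSet_Ioi fun x hx => by rw [abs_of_pos hx]

/-- The factor `2` counts the two signs of a real unit. -/
theorem lintegral_realMeasure_abs (h : ℝ → ENNReal) (hh : Measurable h) :
    ∫⁻ a : ℝˣ, h |(a : ℝ)| ∂realMeasure = 2 * ∫⁻ t in Ioi 0, ENNReal.ofReal t⁻¹ * h t := by
  have hr : range (Units.val : ℝˣ → ℝ) = Iio 0 ∪ Ioi 0 := by
    ext x
    rw [Iio_union_Ioi, mem_compl_singleton_iff]
    exact ⟨by rintro ⟨u, rfl⟩; exact u.ne_zero, fun hx => ⟨Units.mk0 x hx, rfl⟩⟩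
  have hm : Measurable fun x : ℝ => ENNReal.ofReal |x|⁻¹ := by fun_prop
  rw [← measurableEmbedding_units_val.lintegral_map (fun x => h |x|), map_val_realMeasure, hr,
    restrict_withDensity (measurableSet_Iio.union measurableSet_Ioi),
    lintegral_withDensity_eq_lintegral_mul _ hm (by fun_prop),
    lintegral_union measurableSet_Ioi (by
      exact disjoint_left.2 fun x (h1 : x < 0) (h2 : 0 < x) => lt_asymm h1 h2)]
  have h1 := lintegral_Iio_abs fun x => ENNReal.ofReal x⁻¹ * h x
  have h2 : ∫⁻ x in Ioi 0, ENNReal.ofReal |x|⁻¹ * h |x| =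
      ∫⁻ x in Ioi 0, ENNReal.ofReal x⁻¹ * h x :=
    setLIntegral_congr_fun measurableSet_Ioi fun x hx => by rw [abs_of_pos hx]
  simp only [Pi.mul_apply]
  rw [h1, h2, two_mul]

/-- Substitution `t = (n + 1)√r`: since `dt/t = dr/(2r)`, the `1/2` cancels the `2` coming from the
signs. -/
theorem lintegral_Ioi_gaussian (n : ℕ) (g : ℝ → ENNReal) :
    2 * ∫⁻ t in Ioi 0, ENNReal.ofReal t⁻¹ *
        (ENNReal.ofReal (Real.exp (-Real.pi * t ^ 2)) * g ((t * ((n + 1 : ℕ) : ℝ)⁻¹) ^ 2)) =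
      ∫⁻ r in Ioi 0, ENNReal.ofReal (Real.exp (-Real.pi * (n + 1) ^ 2 * r) / r) * g r := by
  have hn : (0 : ℝ) < n + 1 := by positivity
  have himg : (fun r : ℝ => (n + 1 : ℝ) * √r) '' Ioi 0 = Ioi 0 := by
    ext t
    constructor
    · rintro ⟨r, hr, rfl⟩
      exact mul_pos hn (Real.sqrt_pos.2 hr)
    · intro ht
      have ht' : 0 < t / (n + 1) := div_pos ht hn
      refine ⟨(t / (n + 1)) ^ 2, pow_pos ht' 2, ?_⟩
      simp only
      rw [Real.sqrt_sq ht'.le]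
      field_simp
  have hinj : InjOn (fun r : ℝ => (n + 1 : ℝ) * √r) (Ioi 0) := fun a ha b hb hab =>
    Real.sqrt_inj (le_of_lt ha) (le_of_lt hb) |>.1 (mul_left_cancel₀ hn.ne' hab)
  have hder : ∀ r ∈ Ioi (0 : ℝ), HasDerivWithinAt (fun r : ℝ => (n + 1 : ℝ) * √r)
      ((n + 1 : ℝ) * (1 / (2 * √r))) (Ioi 0) r := fun r hr =>
    ((Real.hasDerivAt_sqrt (ne_of_gt hr)).const_mul _).hasDerivWithinAt
  have key := lintegral_image_eq_lintegral_abs_deriv_mul measurableSet_Ioi hder hinj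
    fun t => ENNReal.ofReal t⁻¹ *
        (ENNReal.ofReal (Real.exp (-Real.pi * t ^ 2)) * g ((t * ((n + 1 : ℕ) : ℝ)⁻¹) ^ 2))
  rw [himg] at key
  rw [key, ← lintegral_const_mul' _ _ (by simp)]
  refine setLIntegral_congr_fun measurableSet_Ioi fun r hr => ?_
  have hr' : 0 < √r := Real.sqrt_pos.2 hr
  have hsq : √r ^ 2 = r := Real.sq_sqrt (le_of_lt hr)
  have e1 : ((n + 1 : ℝ) * √r * ((n + 1 : ℕ) : ℝ)⁻¹) ^ 2 = r := by
    push_cast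
    rw [mul_comm (n + 1 : ℝ), mul_assoc, mul_inv_cancel₀ hn.ne', mul_one, hsq]
  have e2 : -Real.pi * ((n + 1 : ℝ) * √r) ^ 2 = -Real.pi * (n + 1) ^ 2 * r := by
    rw [mul_pow, hsq, mul_assoc]
  simp only [e1, e2]
  rw [← mul_assoc, ← mul_assoc, ← mul_assoc, ← ENNReal.ofReal_ofNat 2,
    ← ENNReal.ofReal_mul (by norm_num), ← ENNReal.ofReal_mul (by positivity),
    ← ENNReal.ofReal_mul (by positivity)]
  congr 2
  rw [abs_of_pos (by positivity)]
  have : (n + 1 : ℝ) ≠ 0 := hn.ne'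
  field_simp
  rw [hsq, div_self (ne_of_gt hr)]

/-! ### The weight and the norm on `ℝˣ × 𝔸_fˣ` -/

theorem ideleNorm_eq (x : Idele) :
    ideleNorm x = |((MulEquiv.prodUnits x).1 : ℝ)| * finiteNorm (MulEquiv.prodUnits x).2 := rfl

theorem finprod_localFun (y : FiniteIdele) :
    ∏ᶠ p : Nat.Primes, localFun p ((y : FiniteAdele) p) = integralIdeles.indicator 1 y := by
  by_cases hy : y ∈ integralIdeles
  · rw [indicator_of_mem hy, Pi.one_apply, ← finprod_one]
    exact finprod_congr fun p => indicator_of_mem (hy p) _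
  · rw [indicator_of_notMem hy]
    obtain ⟨p, hp⟩ := not_forall.1 hy
    -- A zero factor is not enough: `finprod` defaults to `1` on infinite support, so finiteness
    -- must come from the restricted product condition.
    refine finprod_eq_zero _ p (indicator_of_notMem hp _) ?_
    refine (FiniteAdele.finite_not_mem (y : FiniteAdele)).subset fun q hq h => hq ?_
    exact indicator_of_mem (s := (PadicInt.subring (q : ℕ) : Set ℚ_[(q : ℕ)])) h _

theorem ideleFun_eq (x : Idele) :
    ideleFun x = Real.exp (-Real.pi * |((MulEquiv.prodUnits x).1 : ℝ)| ^ 2) *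
      integralIdeles.indicator 1 (MulEquiv.prodUnits x).2 := by
  rw [← finprod_localFun, sq_abs]
  rfl

theorem ideleFun_nonneg (x : Idele) : 0 ≤ ideleFun x := by
  rw [ideleFun_eq]
  exact mul_nonneg (Real.exp_pos _).le (indicator_nonneg (fun _ _ => zero_le_one) _)

theorem ideleNorm_pos (x : Idele) : 0 < ideleNorm x := by
  rw [ideleNorm_eq]
  exact mul_pos (abs_pos.2 (Units.ne_zero _)) (finiteNorm_pos _)

theorem measurable_prodUnits : Measurable (MulEquiv.prodUnits (M := ℝ) (N := FiniteAdele)) :=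
  (Homeomorph.prodUnits (α := ℝ) (β := FiniteAdele)).continuous.measurable

theorem measurable_abs_mul_finiteNorm :
    Measurable fun q : ℝˣ × FiniteIdele => |(q.1 : ℝ)| * finiteNorm q.2 :=
  (measurableEmbedding_units_val.measurable.comp measurable_fst).abs.mul
    (measurable_finiteNorm.comp measurable_snd)

theorem measurable_ideleNorm : Measurable ideleNorm :=
  measurable_abs_mul_finiteNorm.comp measurable_prodUnits

theorem measurable_ideleFun : Measurable ideleFun := by
  have h : Measurable fun q : ℝˣ × FiniteIdele => Real.exp (-Real.pi * |(q.1 : ℝ)| ^ 2) *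
      integralIdeles.indicator (1 : FiniteIdele → ℝ) q.2 := by
    refine Measurable.mul ?_
      ((measurable_one.indicator measurableSet_integralIdeles).comp measurable_snd)
    have := (measurableEmbedding_units_val.measurable.comp
      (measurable_fst (α := ℝˣ) (β := FiniteIdele))).abs
    exact Real.measurable_exp.comp (measurable_const.mul (this.pow_const 2))
  exact (funext ideleFun_eq : ideleFun = _) ▸ h.comp measurable_prodUnits

instance : SFinite ideleMeasure := by
  unfold ideleMeasure
  infer_instance

/-! ### Push-forward to the theta measure -/

/-- The density `∑ n, exp (-π (n + 1) ^ 2 r) / r`, which is `(θ(ir) - 1) / (2r)` for `r > 0`. -/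
noncomputable def thetaDensity (r : ℝ) : ENNReal :=
  ∑' n : ℕ, ENNReal.ofReal (Real.exp (-Real.pi * (n + 1) ^ 2 * r) / r)

theorem measurable_thetaDensity : Measurable thetaDensity :=
  Measurable.tsum fun n => by fun_prop

/-- The measure `(θ(ir) - 1) dr / (2r)` on the positive real numbers. -/
noncomputable def thetaMeasure : Measure ℝ := (volume.restrict (Ioi 0)).withDensity thetaDensity

instance : SFinite thetaMeasure := by
  unfold thetaMeasure
  infer_instance

/-- The measure `f(x) d^×x` on the ideles. -/
noncomputable def weightedMeasure : Measure Idele :=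
  ideleMeasure.withDensity fun x => ENNReal.ofReal (ideleFun x)

instance : SFinite weightedMeasure := by
  unfold weightedMeasure
  infer_instance

theorem lintegral_weightedMeasure (g : ℝ → ENNReal) (hg : Measurable g) :
    ∫⁻ x, g (ideleNorm x ^ 2) ∂weightedMeasure = ∫⁻ r, g r ∂thetaMeasure := by
  have hG : Measurable fun x => g (ideleNorm x ^ 2) := hg.comp (measurable_ideleNorm.pow_const 2)
  have hm : Measurable ((fun x => ENNReal.ofReal (ideleFun x)) * fun x => g (ideleNorm x ^ 2)) :=
    measurable_ideleFun.ennreal_ofReal.mul hG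
  rw [weightedMeasure, lintegral_withDensity_eq_lintegral_mul _
    measurable_ideleFun.ennreal_ofReal hG, ideleMeasure,
    lintegral_map hm measurable_prodUnits_symm]
  -- The real variable is integrated first: the result vanishes off the integral finite ideles and
  -- on them depends only on the finite norm, so the sum over slices applies.
  refine (lintegral_prod_symm _ (hm.comp measurable_prodUnits_symm).aemeasurable).trans ?_
  set G : ℝ → ENNReal := fun c => 2 * ∫⁻ t in Ioi 0, ENNReal.ofReal t⁻¹ *
    (ENNReal.ofReal (Real.exp (-Real.pi * t ^ 2)) * g ((t * c) ^ 2)) with hGdef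
  have inner (y : FiniteIdele) : ∫⁻ a : ℝˣ, ((fun x => ENNReal.ofReal (ideleFun x)) *
      fun x => g (ideleNorm x ^ 2)) (MulEquiv.prodUnits.symm (a, y)) ∂realMeasure =
      integralIdeles.indicator (fun y => G (finiteNorm y)) y := by
    by_cases hy : y ∈ integralIdeles
    · rw [indicator_of_mem hy, hGdef]
      simp only
      rw [← lintegral_realMeasure_abs (fun t => ENNReal.ofReal (Real.exp (-Real.pi * t ^ 2)) *
        g ((t * finiteNorm y) ^ 2)) (by fun_prop)]
      refine lintegral_congr fun a => ?_
      rw [Pi.mul_apply, ideleFun_eq, ideleNorm_eq, MulEquiv.apply_symm_apply, indicator_of_mem hy,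
        Pi.one_apply, mul_one]
    · rw [indicator_of_notMem hy]
      refine lintegral_eq_zero_of_ae_eq_zero (Filter.Eventually.of_forall fun a => ?_)
      beta_reduce
      rw [Pi.mul_apply, ideleFun_eq, MulEquiv.apply_symm_apply, indicator_of_notMem hy, mul_zero,
        ENNReal.ofReal_zero, zero_mul, Pi.zero_apply]
  refine (lintegral_congr inner).trans ?_
  rw [lintegral_indicator measurableSet_integralIdeles,
    setLIntegral_integralIdeles, thetaMeasure,
    lintegral_withDensity_eq_lintegral_mul _ measurable_thetaDensity hg]
  simp only [hGdef, lintegral_Ioi_gaussian]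
  rw [← lintegral_tsum fun n => by fun_prop]
  exact lintegral_congr fun r => ENNReal.tsum_mul_right

theorem map_weightedMeasure :
    weightedMeasure.map (fun x => ideleNorm x ^ 2) = thetaMeasure := by
  refine Measure.ext_of_lintegral _ fun g hg => ?_
  rw [lintegral_map hg (measurable_ideleNorm.pow_const 2), lintegral_weightedMeasure g hg]

/-! ### Moments and absolute convergence -/

theorem lintegral_Ioi_rpow_mul_exp {a b : ℝ} (ha : 0 < a) (hb : 0 < b) :
    ∫⁻ r in Ioi 0, ENNReal.ofReal (r ^ (a - 1) * Real.exp (-(b * r))) =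
      ENNReal.ofReal ((1 / b) ^ a * Real.Gamma a) := by
  have h := Real.integral_rpow_mul_exp_neg_mul_Ioi ha hb
  have hpos : 0 < (1 / b) ^ a * Real.Gamma a :=
    mul_pos (Real.rpow_pos_of_pos (by positivity) a) (Real.Gamma_pos_of_pos ha)
  -- A Bochner integral with nonzero value is integrable, since the default value is `0`.
  rw [← h, ofReal_integral_eq_lintegral_ofReal (Integrable.of_integral_ne_zero (h ▸ hpos.ne'))]
  filter_upwards [ae_restrict_mem measurableSet_Ioi] with r hr
  exact mul_nonneg (Real.rpow_nonneg (le_of_lt hr) _) (Real.exp_pos _).le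

/-- The terms are a constant times `(n + 1)^(-2a)`, the series of `ζ(2a)`. -/
theorem summable_gaussian_moment {a : ℝ} (ha : 1 / 2 < a) :
    Summable fun n : ℕ => (1 / (Real.pi * (n + 1) ^ 2)) ^ a * Real.Gamma a := by
  have h : Summable fun n : ℕ => (1 / Real.pi) ^ a * Real.Gamma a * (1 / ((n + 1 : ℕ) : ℝ) ^ (2 * a)) :=
    (((summable_nat_add_iff 1).2 (Real.summable_one_div_nat_rpow.2 (by linarith))).mul_left _)
  refine h.congr fun n => ?_
  have hn : (0 : ℝ) ≤ n + 1 := by positivity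
  rw [← one_div_mul_one_div, Real.mul_rpow (by positivity) (by positivity),
    Real.div_rpow zero_le_one (by positivity) (x := 1) (y := (n + 1 : ℝ) ^ 2), Real.one_rpow,
    ← Real.rpow_natCast, ← Real.rpow_mul hn, Nat.cast_two, Nat.cast_add_one]
  ring

/-- The moments of order greater than `1 / 2` of `(θ(ir) - 1) dr / (2r)` are finite. -/
theorem integrable_rpow_thetaMeasure {a : ℝ} (ha : 1 / 2 < a) :
    Integrable (fun r : ℝ => r ^ a) thetaMeasure := by
  have hm : Measurable fun r : ℝ => r ^ a := measurable_id.pow_const a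
  refine ⟨hm.aestronglyMeasurable, ?_⟩
  rw [hasFiniteIntegral_iff_enorm, thetaMeasure,
    lintegral_withDensity_eq_lintegral_mul _ measurable_thetaDensity hm.enorm]
  have h : ∫⁻ r in Ioi 0, (thetaDensity * fun r : ℝ => ‖r ^ a‖ₑ) r =
      ∫⁻ r in Ioi 0, ∑' n : ℕ,
        ENNReal.ofReal (r ^ (a - 1) * Real.exp (-(Real.pi * (n + 1) ^ 2 * r))) := by
    refine setLIntegral_congr_fun measurableSet_Ioi fun r (hr : 0 < r) => ?_
    rw [Pi.mul_apply, thetaDensity, ← ENNReal.tsum_mul_right]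
    refine tsum_congr fun n => ?_
    rw [Real.enorm_of_nonneg (Real.rpow_nonneg hr.le a), ← ENNReal.ofReal_mul (by positivity),
      Real.rpow_sub_one hr.ne']
    congr 1
    rw [neg_mul, neg_mul]
    ring
  rw [h, lintegral_tsum fun n => by fun_prop]
  simp only [fun n : ℕ => lintegral_Ioi_rpow_mul_exp (a := a) (b := Real.pi * (n + 1) ^ 2)
    (by linarith) (by positivity)]
  rw [← ENNReal.ofReal_tsum_of_nonneg _ (summable_gaussian_moment ha)]
  · exact ENNReal.ofReal_lt_top
  · intro n
    exact mul_nonneg (Real.rpow_nonneg (by positivity) a) (Real.Gamma_pos_of_pos (by linarith)).le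

theorem thetaMeasure_prod : thetaMeasure.prod thetaMeasure =
    (volume.restrict (Ioi 0 ×ˢ Ioi 0)).withDensity
      fun z : ℝ × ℝ => thetaDensity z.1 * thetaDensity z.2 := by
  rw [thetaMeasure, prod_withDensity measurable_thetaDensity measurable_thetaDensity,
    Measure.prod_restrict, Measure.volume_eq_prod]

theorem ae_thetaMeasure_prod_mem :
    ∀ᵐ z ∂(thetaMeasure.prod thetaMeasure), z ∈ (Ioi 0 ×ˢ Ioi 0 : Set (ℝ × ℝ)) := by
  rw [thetaMeasure_prod]
  exact (withDensity_absolutelyContinuous _ _).ae_le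
    (ae_restrict_mem (measurableSet_Ioi.prod measurableSet_Ioi))

/-- The function `r₁ ^ (s₁ / 2) r₂ ^ (s₂ / 2)`, cut off to `r₁ > r₂`. -/
noncomputable def truncatedPower (s₁ s₂ : ℂ) : ℝ × ℝ → ℂ :=
  indicator {r | r.1 > r.2} fun r => (r.1 : ℂ) ^ (s₁ / 2) * (r.2 : ℂ) ^ (s₂ / 2)

theorem truncatedPower_of_gt (s₁ s₂ : ℂ) {z : ℝ × ℝ} (h : z.1 > z.2) :
    truncatedPower s₁ s₂ z = (z.1 : ℂ) ^ (s₁ / 2) * (z.2 : ℂ) ^ (s₂ / 2) :=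
  indicator_of_mem (s := {r : ℝ × ℝ | r.1 > r.2}) h _

theorem truncatedPower_of_not_gt (s₁ s₂ : ℂ) {z : ℝ × ℝ} (h : ¬ z.1 > z.2) :
    truncatedPower s₁ s₂ z = 0 :=
  indicator_of_notMem (s := {r : ℝ × ℝ | r.1 > r.2}) h _

theorem measurable_truncatedPower (s₁ s₂ : ℂ) : Measurable (truncatedPower s₁ s₂) := by
  refine Measurable.indicator ?_ (measurableSet_lt measurable_snd measurable_fst)
  exact ((Complex.measurable_ofReal.comp measurable_fst).pow_const _).mul
    ((Complex.measurable_ofReal.comp measurable_snd).pow_const _)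

/-- On `r₁ > r₂` the factor `(r₁/r₂)^t` with `t > 0` is at least one. Inserting it shifts weight
from the second exponent to the first and dominates the function by a product of two finite moments.
-/
theorem integrable_truncatedPower {s₁ s₂ : ℂ} (h₂ : 1 < s₂.re) (h₁₂ : 2 < (s₁ + s₂).re) :
    Integrable (truncatedPower s₁ s₂) (thetaMeasure.prod thetaMeasure) := by
  rw [Complex.add_re] at h₁₂
  -- The bounds say `t > 0`, `Re s₁ / 2 + t > 1/2` and `Re s₂ / 2 - t > 1/2`. Such `t` exists
  -- exactly when `Re s₂ > 1` and `Re (s₁ + s₂) > 2`.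
  obtain ⟨t, ht1, ht2⟩ : ∃ t, max 0 ((1 - s₁.re) / 2) < t ∧ t < (s₂.re - 1) / 2 :=
    exists_between (max_lt (by linarith) (by linarith))
  obtain ⟨ht0, ht1⟩ := max_lt_iff.1 ht1
  have hb := (integrable_rpow_thetaMeasure (a := s₁.re / 2 + t) (by linarith)).mul_prod
    (integrable_rpow_thetaMeasure (a := s₂.re / 2 - t) (by linarith))
  refine hb.mono' (measurable_truncatedPower s₁ s₂).aestronglyMeasurable ?_
  filter_upwards [ae_thetaMeasure_prod_mem] with z hz
  obtain ⟨hz1, hz2⟩ : 0 < z.1 ∧ 0 < z.2 := hz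
  by_cases h : z.1 > z.2
  · rw [truncatedPower_of_gt s₁ s₂ h, norm_mul, Complex.norm_cpow_eq_rpow_re_of_pos hz1,
      Complex.norm_cpow_eq_rpow_re_of_pos hz2, Complex.div_ofNat_re, Complex.div_ofNat_re,
      Real.rpow_add hz1, Real.rpow_sub hz2]
    have hle : z.2 ^ t ≤ z.1 ^ t := Real.rpow_le_rpow hz2.le (le_of_lt h) ht0.le
    have h1 : 1 ≤ z.1 ^ t / z.2 ^ t := (one_le_div (Real.rpow_pos_of_pos hz2 t)).2 hle
    calc _ ≤ z.1 ^ (s₁.re / 2) * z.2 ^ (s₂.re / 2) * (z.1 ^ t / z.2 ^ t) :=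
          le_mul_of_one_le_right (mul_nonneg (Real.rpow_nonneg hz1.le _)
            (Real.rpow_nonneg hz2.le _)) h1
      _ = _ := by ring
  · rw [truncatedPower_of_not_gt s₁ s₂ h, norm_zero]
    exact mul_nonneg (Real.rpow_nonneg hz1.le _) (Real.rpow_nonneg hz2.le _)

/-! ### The theta side -/

theorem hasSum_thetaDensity {r : ℝ} (hr : 0 < r) :
    HasSum (fun n : ℕ => ((Real.exp (-Real.pi * (n + 1) ^ 2 * r) / r : ℝ) : ℂ))
      ((jacobiTheta (Complex.I * r) - 1) / 2 / r) := by
  have h := (hasSum_nat_jacobiTheta (τ := Complex.I * r) (by simpa using hr)).div_const (r : ℂ)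
  refine (funext fun n : ℕ => ?_ : (fun n : ℕ => _) = _) ▸ h
  rw [Complex.ofReal_div, Complex.ofReal_exp]
  push_cast
  congr 2
  linear_combination (-Real.pi * (n + 1) ^ 2 * r : ℂ) * Complex.I_sq

theorem summable_thetaDensity {r : ℝ} (hr : 0 < r) :
    Summable fun n : ℕ => Real.exp (-Real.pi * (n + 1) ^ 2 * r) / r :=
  Complex.summable_ofReal.1 (hasSum_thetaDensity hr).summable

theorem thetaDensity_eq {r : ℝ} (hr : 0 < r) :
    thetaDensity r = ENNReal.ofReal (∑' n : ℕ, Real.exp (-Real.pi * (n + 1) ^ 2 * r) / r) :=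
  (ENNReal.ofReal_tsum_of_nonneg (fun n => by positivity) (summable_thetaDensity hr)).symm

theorem thetaDensity_ne_top {r : ℝ} (hr : 0 < r) : thetaDensity r ≠ ⊤ :=
  thetaDensity_eq hr ▸ ENNReal.ofReal_ne_top

theorem toReal_thetaDensity {r : ℝ} (hr : 0 < r) :
    ((thetaDensity r).toReal : ℂ) = (jacobiTheta (Complex.I * r) - 1) / 2 / r := by
  rw [thetaDensity_eq hr, ENNReal.toReal_ofReal (tsum_nonneg fun n => by positivity),
    Complex.ofReal_tsum, (hasSum_thetaDensity hr).tsum_eq]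

theorem measurableSet_thetaDomain : MeasurableSet thetaDomain :=
  (measurableSet_lt measurable_snd measurable_fst).inter
    (measurableSet_lt measurable_const measurable_snd)

theorem thetaDomain_subset : thetaDomain ⊆ Ioi 0 ×ˢ Ioi 0 :=
  fun _ hz => ⟨hz.2.trans hz.1, hz.2⟩

/-- The `4` is `2 · 2`: each density is `(θ(ir) - 1) / (2r)`, summing over `n ≥ 1` only. -/
theorem indicator_thetaIntegrand (s₁ s₂ : ℂ) {z : ℝ × ℝ} (hz : z ∈ (Ioi 0 ×ˢ Ioi 0 : Set (ℝ × ℝ))) :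
    thetaDomain.indicator (thetaIntegrand s₁ s₂) z =
      4 * ((thetaDensity z.1 * thetaDensity z.2).toReal • truncatedPower s₁ s₂ z) := by
  by_cases h : z.1 > z.2
  · rw [indicator_of_mem (show z ∈ thetaDomain from ⟨h, hz.2⟩), truncatedPower_of_gt s₁ s₂ h,
      ENNReal.toReal_mul, Complex.real_smul, Complex.ofReal_mul,
      toReal_thetaDensity hz.1, toReal_thetaDensity hz.2, thetaIntegrand]
    ring
  · rw [indicator_of_notMem (fun h' : z ∈ thetaDomain => h h'.1),
      truncatedPower_of_not_gt s₁ s₂ h, smul_zero, mul_zero]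

theorem ae_thetaDensity_lt_top : ∀ᵐ z ∂(volume.restrict (Ioi 0 ×ˢ Ioi 0 : Set (ℝ × ℝ))),
    thetaDensity z.1 * thetaDensity z.2 < ⊤ := by
  filter_upwards [ae_restrict_mem (measurableSet_Ioi.prod measurableSet_Ioi)] with z hz
  exact ENNReal.mul_lt_top (thetaDensity_ne_top hz.1).lt_top (thetaDensity_ne_top hz.2).lt_top

theorem measurable_thetaDensity_mul :
    Measurable fun z : ℝ × ℝ => thetaDensity z.1 * thetaDensity z.2 :=
  (measurable_thetaDensity.comp measurable_fst).mul (measurable_thetaDensity.comp measurable_snd)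

theorem integrableOn_thetaIntegrand {s₁ s₂ : ℂ} (h₂ : 1 < s₂.re) (h₁₂ : 2 < (s₁ + s₂).re) :
    IntegrableOn (thetaIntegrand s₁ s₂) thetaDomain := by
  have h := integrable_truncatedPower h₂ h₁₂
  rw [thetaMeasure_prod, integrable_withDensity_iff_integrable_smul' measurable_thetaDensity_mul
    ae_thetaDensity_lt_top] at h
  have h' : IntegrableOn (thetaDomain.indicator (thetaIntegrand s₁ s₂)) (Ioi 0 ×ˢ Ioi 0) :=
    (integrableOn_congr_fun (fun z hz => indicator_thetaIntegrand s₁ s₂ hz)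
      (measurableSet_Ioi.prod measurableSet_Ioi)).2 (h.const_mul 4)
  rw [IntegrableOn, integrable_indicator_iff measurableSet_thetaDomain, IntegrableOn,
    Measure.restrict_restrict measurableSet_thetaDomain,
    inter_eq_self_of_subset_left thetaDomain_subset] at h'
  exact h'

theorem setIntegral_thetaIntegrand (s₁ s₂ : ℂ) :
    ∫ r in thetaDomain, thetaIntegrand s₁ s₂ r =
      4 * ∫ z, truncatedPower s₁ s₂ z ∂(thetaMeasure.prod thetaMeasure) := by
  rw [thetaMeasure_prod, integral_withDensity_eq_integral_toReal_smul measurable_thetaDensity_mul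
    ae_thetaDensity_lt_top, ← integral_const_mul,
    ← inter_eq_self_of_subset_right thetaDomain_subset,
    ← setIntegral_indicator measurableSet_thetaDomain]
  exact setIntegral_congr_fun (measurableSet_Ioi.prod measurableSet_Ioi)
    fun z hz => indicator_thetaIntegrand s₁ s₂ hz

/-! ### The adelic side -/

/-- The map `(x₁, x₂) ↦ (|x₁| ^ 2, |x₂| ^ 2)`. -/
noncomputable def sqNormPair (x : Idele × Idele) : ℝ × ℝ := (ideleNorm x.1 ^ 2, ideleNorm x.2 ^ 2)

theorem measurable_sqNormPair : Measurable sqNormPair :=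
  ((measurable_ideleNorm.comp measurable_fst).pow_const 2).prodMk
    ((measurable_ideleNorm.comp measurable_snd).pow_const 2)

theorem map_sqNormPair : (weightedMeasure.prod weightedMeasure).map sqNormPair =
    thetaMeasure.prod thetaMeasure := by
  rw [← map_weightedMeasure]
  exact (Measure.map_prod_map _ _ (measurable_ideleNorm.pow_const 2)
    (measurable_ideleNorm.pow_const 2)).symm

theorem weightedMeasure_prod : weightedMeasure.prod weightedMeasure =
    (ideleMeasure.prod ideleMeasure).withDensity
      fun x => ENNReal.ofReal (ideleFun x.1) * ENNReal.ofReal (ideleFun x.2) :=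
  prod_withDensity measurable_ideleFun.ennreal_ofReal measurable_ideleFun.ennreal_ofReal

theorem measurable_ideleFun_mul : Measurable fun x : Idele × Idele =>
    ENNReal.ofReal (ideleFun x.1) * ENNReal.ofReal (ideleFun x.2) :=
  (measurable_ideleFun.ennreal_ofReal.comp measurable_fst).mul
    (measurable_ideleFun.ennreal_ofReal.comp measurable_snd)

theorem measurableSet_adelicDomain : MeasurableSet adelicDomain :=
  measurableSet_lt (measurable_ideleNorm.comp measurable_snd)
    (measurable_ideleNorm.comp measurable_fst)

/-- For positive `c` the principal logarithm is real and `log c² = 2 log c`, so no branch problem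
arises. -/
theorem sq_cpow_half {c : ℝ} (hc : 0 < c) (s : ℂ) : ((c ^ 2 : ℝ) : ℂ) ^ (s / 2) = (c : ℂ) ^ s := by
  have hc' : (c : ℂ) ≠ 0 := Complex.ofReal_ne_zero.2 hc.ne'
  have hc2 : ((c ^ 2 : ℝ) : ℂ) ≠ 0 := Complex.ofReal_ne_zero.2 (pow_pos hc 2).ne'
  rw [Complex.cpow_def_of_ne_zero hc', Complex.cpow_def_of_ne_zero hc2,
    ← Complex.ofReal_log (pow_pos hc 2).le, ← Complex.ofReal_log hc.le, Real.log_pow]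
  push_cast
  ring_nf

/-- Norms are positive, so comparing them is the same as comparing their squares. The integrand thus
factors through `sqNormPair` apart from the weight, which the push-forward absorbs. -/
theorem indicator_adelicIntegrand (s₁ s₂ : ℂ) (x : Idele × Idele) :
    adelicDomain.indicator (adelicIntegrand s₁ s₂) x =
      (ENNReal.ofReal (ideleFun x.1) * ENNReal.ofReal (ideleFun x.2)).toReal •
        truncatedPower s₁ s₂ (sqNormPair x) := by
  have hiff : x ∈ adelicDomain ↔ (sqNormPair x).1 > (sqNormPair x).2 :=
    (pow_lt_pow_iff_left₀ (ideleNorm_pos x.2).le (ideleNorm_pos x.1).le two_ne_zero).symm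
  by_cases h : x ∈ adelicDomain
  · rw [indicator_of_mem h, truncatedPower_of_gt s₁ s₂ (hiff.1 h), sqNormPair,
      sq_cpow_half (ideleNorm_pos _), sq_cpow_half (ideleNorm_pos _), ENNReal.toReal_mul,
      ENNReal.toReal_ofReal (ideleFun_nonneg _), ENNReal.toReal_ofReal (ideleFun_nonneg _),
      Complex.real_smul, Complex.ofReal_mul, adelicIntegrand]
    ring
  · rw [indicator_of_notMem h, truncatedPower_of_not_gt s₁ s₂ (mt hiff.2 h), smul_zero]

theorem integrableOn_adelicIntegrand {s₁ s₂ : ℂ} (h₂ : 1 < s₂.re) (h₁₂ : 2 < (s₁ + s₂).re) :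
    IntegrableOn (adelicIntegrand s₁ s₂) adelicDomain (ideleMeasure.prod ideleMeasure) := by
  have h := integrable_truncatedPower h₂ h₁₂
  rw [← map_sqNormPair, integrable_map_measure
    (measurable_truncatedPower s₁ s₂).aestronglyMeasurable measurable_sqNormPair.aemeasurable,
    weightedMeasure_prod, integrable_withDensity_iff_integrable_smul' measurable_ideleFun_mul
      (Filter.Eventually.of_forall fun x =>
        ENNReal.mul_lt_top ENNReal.ofReal_lt_top ENNReal.ofReal_lt_top)] at h
  rw [← integrable_indicator_iff measurableSet_adelicDomain]
  exact h.congr (Filter.Eventually.of_forall fun x => (indicator_adelicIntegrand s₁ s₂ x).symm)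

theorem setIntegral_adelicIntegrand (s₁ s₂ : ℂ) :
    ∫ x in adelicDomain, adelicIntegrand s₁ s₂ x ∂(ideleMeasure.prod ideleMeasure) =
      ∫ z, truncatedPower s₁ s₂ z ∂(thetaMeasure.prod thetaMeasure) := by
  rw [← map_sqNormPair, integral_map measurable_sqNormPair.aemeasurable
    (measurable_truncatedPower s₁ s₂).aestronglyMeasurable, weightedMeasure_prod,
    integral_withDensity_eq_integral_toReal_smul measurable_ideleFun_mul
      (Filter.Eventually.of_forall fun x =>
        ENNReal.mul_lt_top ENNReal.ofReal_lt_top ENNReal.ofReal_lt_top),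
    ← integral_indicator measurableSet_adelicDomain]
  exact integral_congr_ae (Filter.Eventually.of_forall fun x => indicator_adelicIntegrand s₁ s₂ x)

end Adelic

theorem theorem5p1 (s₁ s₂ : ℂ) (h₂ : 1 < s₂.re) (h₁₂ : 2 < (s₁ + s₂).re) :
    MeasureTheory.IntegrableOn (Adelic.adelicIntegrand s₁ s₂) Adelic.adelicDomain
        (Adelic.ideleMeasure.prod Adelic.ideleMeasure) ∧
      MeasureTheory.IntegrableOn (Adelic.thetaIntegrand s₁ s₂) Adelic.thetaDomain
        MeasureTheory.volume ∧
      ∫ x in Adelic.adelicDomain, Adelic.adelicIntegrand s₁ s₂ x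
          ∂(Adelic.ideleMeasure.prod Adelic.ideleMeasure) =
        (1 / 4 : ℂ) * ∫ r in Adelic.thetaDomain, Adelic.thetaIntegrand s₁ s₂ r := by
  refine ⟨Adelic.integrableOn_adelicIntegrand h₂ h₁₂, Adelic.integrableOn_thetaIntegrand h₂ h₁₂, ?_⟩
  rw [Adelic.setIntegral_adelicIntegrand, Adelic.setIntegral_thetaIntegrand, ← mul_assoc]
  norm_num
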